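/- A (Kripke) frame is a pair $(W,R)$ with $W\neq\varnothing$ and $R\subseteq W\times W$. Put $R^0=\{(x,x)\mid x\in W\}$, $R^{i+1}=R^i\circ R$, and let $R^*=\bigcup_{i\ge 0}R^i$ be the reflexive transitive closure of $R$. The height of $(W,R)$ is the height of its skeleton, i.e. of the partially ordered set of equivalence classes of the relation $x\sim y \iff (xR^*y \text{ and } yR^*x)$, ordered by $[x]\le[y]\iff xR^*y$; a partial order has height $k\in\mathbb N$ if it contains a chain of cardinality $k$ and no chain of larger cardinality. For natural numbers $m,n,h$ let - $\mathcal F(m,n,h)$ be the class of all frames $(W,R)$ with $R^n\subseteq R^m$ whose height is finite and at most $h$; - $\mathcal G(m,h)$ be the class of all frames $(W,R)$ with $R^*=\bigcup_{0\le i\le m}R^i$ ($m$-transitive frames) whose height is finite and at most $h$. Propositional modal formulas are built from countably many variables and the constants $\bot,\top$ by means of $\land,\lor,\lnot,\to,\leftrightarrow$ and a unary modality $\Diamond$; they are interpreted in frames by the usual Kripke semantics ($\Diamond\varphi$ is true at $w$ iff $\varphi$ is true at some $v$ with $wRv$). The logic of a class of frames is the set of all formulas that are true at every point of every frame of the class under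 every valuation of the variables. A set of formulas is decidable if there is an algorithm deciding membership of a formula in it. **Theorem.** For all $n>m\ge 1$ and $h\ge 1$, the logic of $\mathcal F(m,n,h)$ and the logic of $\mathcal G(m,h)$ are decidable. -/

import Mathlib

universe u

namespace ModalLogic

/-! ### Modal formulas -/

/-- Propositional unimodal formulas over the countable set of variables `p₀, p₁, …`. -/
inductive Formula : Type
  | var : ℕ → Formula
  | bot : Formula
  | top : Formula
  | neg : Formula → Formula
  | and : Formula → Formula → Formula
  | or : Formula → Formula → Formula
  | imp : Formula → Formula → Formula
  | iff : Formula → Formula → Formula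
  | dia : Formula → Formula

namespace Formula

/-- The Gödel number of a formula, by structural recursion. -/
def code : Formula → ℕ
  | bot => 0
  | top => 1
  | var i => 7 * i + 2
  | neg φ => 7 * code φ + 3
  | dia φ => 7 * code φ + 4
  | and φ ψ => 7 * Nat.pair (code φ) (code ψ) + 5
  | or φ ψ => 7 * Nat.pair (code φ) (code ψ) + 6
  | imp φ ψ => 7 * Nat.pair (code φ) (code ψ) + 7
  | iff φ ψ => 7 * Nat.pair (code φ) (code ψ) + 8

/-- The formula with a given Gödel number. -/
def ofCode : ℕ → Formula
  | 0 => bot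
  | 1 => top
  | n + 2 =>
    have _h : n / 7 < n + 2 := lt_of_le_of_lt (Nat.div_le_self n 7) (by omega)
    have _hl : (n / 7).unpair.1 < n + 2 := lt_of_le_of_lt (Nat.unpair_left_le _) _h
    have _hr : (n / 7).unpair.2 < n + 2 := lt_of_le_of_lt (Nat.unpair_right_le _) _h
    match n % 7 with
    | 0 => var (n / 7)
    | 1 => neg (ofCode (n / 7))
    | 2 => dia (ofCode (n / 7))
    | 3 => and (ofCode (n / 7).unpair.1) (ofCode (n / 7).unpair.2)
    | 4 => or (ofCode (n / 7).unpair.1) (ofCode (n / 7).unpair.2)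
    | 5 => imp (ofCode (n / 7).unpair.1) (ofCode (n / 7).unpair.2)
    | _ => iff (ofCode (n / 7).unpair.1) (ofCode (n / 7).unpair.2)

theorem ofCode_code (φ : Formula) : ofCode (code φ) = φ := by
  have hd : ∀ k r, r < 7 → (7 * k + r) / 7 = k := by intro k r hr; omega
  have hm : ∀ k r, r < 7 → (7 * k + r) % 7 = r := by intro k r hr; omega
  induction φ with
  | bot => simp [code, ofCode]
  | top => simp [code, ofCode]
  | var i =>
    rw [code, ofCode]
    simp
  | neg φ ih =>
    rw [code, show 7 * code φ + 3 = (7 * code φ + 1) + 2 from rfl, ofCode]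
    simp [hd, hm, ih]
  | dia φ ih =>
    rw [code, show 7 * code φ + 4 = (7 * code φ + 2) + 2 from rfl, ofCode]
    simp [hd, hm, ih]
  | and φ ψ ih₁ ih₂ =>
    rw [code, show ∀ k, 7 * k + 5 = (7 * k + 3) + 2 from fun _ => rfl, ofCode]
    simp [hd, hm, ih₁, ih₂]
  | or φ ψ ih₁ ih₂ =>
    rw [code, show ∀ k, 7 * k + 6 = (7 * k + 4) + 2 from fun _ => rfl, ofCode]
    simp [hd, hm, ih₁, ih₂]
  | imp φ ψ ih₁ ih₂ =>
    rw [code, show ∀ k, 7 * k + 7 = (7 * k + 5) + 2 from fun _ => rfl, ofCode]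
    simp [hd, hm, ih₁, ih₂]
  | iff φ ψ ih₁ ih₂ =>
    rw [code, show ∀ k, 7 * k + 8 = (7 * k + 6) + 2 from fun _ => rfl, ofCode]
    simp [hd, hm, ih₁, ih₂]

theorem code_ofCode (n : ℕ) : code (ofCode n) = n := by
  induction n using Nat.strong_induction_on with
  | _ n ih =>
    match n, ih with
    | 0, _ => simp [code, ofCode]
    | 1, _ => simp [code, ofCode]
    | n + 2, ih =>
      have h : n / 7 < n + 2 := lt_of_le_of_lt (Nat.div_le_self n 7) (by omega)
      have h0 := ih _ h
      have h1 := ih _ (lt_of_le_of_lt (Nat.unpair_left_le _) h)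
      have h2 := ih _ (lt_of_le_of_lt (Nat.unpair_right_le _) h)
      have hr : n % 7 < 7 := Nat.mod_lt _ (by norm_num)
      have hn := Nat.div_add_mod n 7
      rw [ofCode]
      generalize n % 7 = r at hr hn
      interval_cases r <;> simp [code, h0, h1, h2] <;> omega

/-- Formulas are identified with natural numbers through the Gödel numbering; this is what
computability of a set of formulas refers to. -/
instance : Denumerable Formula :=
  Denumerable.mk' ⟨code, ofCode, ofCode_code, code_ofCode⟩

end Formula

/-! ### Kripke frames and logics -/

/-- A (Kripke) frame: a nonempty set with a binary relation. -/
structure Frame : Type (u + 1) where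
  W : Type u
  nonempty : Nonempty W
  R : W → W → Prop

/-- Truth of a formula at a point of the model `(F, θ)`. -/
def Formula.Sat (F : Frame.{u}) (θ : ℕ → Set F.W) : Formula → F.W → Prop
  | .var i, w => w ∈ θ i
  | .bot, _ => False
  | .top, _ => True
  | .neg φ, w => ¬ φ.Sat F θ w
  | .and φ ψ, w => φ.Sat F θ w ∧ ψ.Sat F θ w
  | .or φ ψ, w => φ.Sat F θ w ∨ ψ.Sat F θ w
  | .imp φ ψ, w => φ.Sat F θ w → ψ.Sat F θ w
  | .iff φ ψ, w => (φ.Sat F θ w ↔ ψ.Sat F θ w)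
  | .dia φ, w => ∃ v, F.R w v ∧ φ.Sat F θ v

/-- Validity of a formula in a frame: truth at every point of every model over the frame. -/
def Frame.Valid (F : Frame.{u}) (φ : Formula) : Prop :=
  ∀ (θ : ℕ → Set F.W) (w : F.W), φ.Sat F θ w

/-- The logic of a class of frames: the set of formulas valid in all frames of the class. -/
def Log (C : Set Frame.{u}) : Set Formula :=
  {φ | ∀ F ∈ C, F.Valid φ}

/-- A set of formulas (e.g. a logic) is decidable if its membership problem is solvable by an
algorithm. -/
def IsDecidable (L : Set Formula) : Prop :=
  ComputablePred fun φ : Formula => φ ∈ L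

/-! ### Powers, reflexive transitive closure, height -/

/-- The powers of a relation: `R⁰` is the identity and `Rⁱ⁺¹ = Rⁱ ∘ R`. -/
def relPow {W : Type u} (R : W → W → Prop) : ℕ → W → W → Prop
  | 0 => Eq
  | i + 1 => Relation.Comp (relPow R i) R

namespace Frame

/-- `R*`, the reflexive transitive closure of the relation of the frame. -/
def Star (F : Frame.{u}) : F.W → F.W → Prop :=
  Relation.ReflTransGen F.R

/-- `x ∼ y` if `x R* y` and `y R* x`. -/
def clusterSetoid (F : Frame.{u}) : Setoid F.W where
  r x y := F.Star x y ∧ F.Star y x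
  iseqv :=
    { refl := fun _ => ⟨Relation.ReflTransGen.refl, Relation.ReflTransGen.refl⟩
      symm := fun h => ⟨h.2, h.1⟩
      trans := fun h k => ⟨Relation.ReflTransGen.trans h.1 k.1,
        Relation.ReflTransGen.trans k.2 h.2⟩ }

/-- The skeleton of the frame: the set of its clusters. -/
def Skeleton (F : Frame.{u}) : Type u :=
  Quotient F.clusterSetoid

/-- The order of the skeleton: `[x] ≤ [y]` iff `x R* y`. -/
instance (F : Frame.{u}) : PartialOrder F.Skeleton where
  le := Quotient.lift₂ F.Star fun _ _ _ _ hx hy => propext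
    ⟨fun h => (Relation.ReflTransGen.trans hx.2 h).trans hy.1,
      fun h => (Relation.ReflTransGen.trans hx.1 h).trans hy.2⟩
  le_refl a := Quotient.inductionOn a fun _ => Relation.ReflTransGen.refl
  le_trans a b c := Quotient.inductionOn₃ a b c fun _ _ _ => Relation.ReflTransGen.trans
  le_antisymm a b := Quotient.inductionOn₂ a b fun _ _ h k => Quotient.sound ⟨h, k⟩

end Frame

/-- The partial order `P` has (finite) height `k`: there is a chain of cardinality `k` in `P`,
and no chain of larger cardinality. -/
def HasHeight (P : Type u) [PartialOrder P] (k : ℕ) : Prop :=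
  (∃ C : Set P, IsChain (· ≤ ·) C ∧ C.encard = k) ∧
    ∀ C : Set P, IsChain (· ≤ ·) C → C.encard ≤ k

/-- The height of the frame, i.e. the height of its skeleton, is finite and at most `h`. -/
def Frame.HeightLE (F : Frame.{u}) (h : ℕ) : Prop :=
  ∃ k ≤ h, HasHeight F.Skeleton k

/-! ### The two families of classes of frames -/

/-- `(m, n)`-frames: `Rⁿ ⊆ Rᵐ`. -/
def classF (m n : ℕ) : Set Frame.{u} :=
  {F | ∀ x y, relPow F.R n x y → relPow F.R m x y}

/-- `m`-transitive frames: `R* = ⋃_{i ≤ m} Rⁱ`. -/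
def classG (m : ℕ) : Set Frame.{u} :=
  {F | ∀ x y, F.Star x y ↔ ∃ i ≤ m, relPow F.R i x y}

/-- `(m, n)`-frames of height at most `h`. -/
def classFH (m n h : ℕ) : Set Frame.{u} :=
  {F | F ∈ classF m n ∧ F.HeightLE h}

/-- `m`-transitive frames of height at most `h`. -/
def classGH (m h : ℕ) : Set Frame.{u} :=
  {F | F ∈ classG m ∧ F.HeightLE h}

end ModalLogic

namespace ModalLogic

/-! ### Paths -/

/-! Both logics have the finite model property with a primitive recursive bound on the size of a
countermodel, and membership of a finite frame in either class can be checked by bounded search.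

Let `φ` fail in a frame `F` of the class. Filtration identifies points of the same colour, for a
finite colouring that fixes the truth values of all formulas with code at most that of `φ`
(subformulas included), and takes the least relation making the quotient map a homomorphism. Then
`φ` still fails in the quotient. The difficulty is that the quotient must stay in the class: a path
in it may jump between points of a fibre. The remedy is `LiftsMod`: after any jump, the next edge is
replaced by a path in `F` of positive length congruent to 1 modulo `N`. With `N = n - m`, a quotient
path of length `n` lifts to one of length `L ≥ n` with `L ≡ n ≡ m`, which `Rⁿ ⊆ Rᵐ` shortens to
length `m`, and this projects back (`IsMinQuotient.mem_classF`). For `m`-transitivity it suffices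
that reachability lifts, so `N = 1` serves. Strict chains of clusters lift too, so height does not
grow.

Finite height supplies the colouring, by recursion on depth: a colour records a label of the point,
the colours it sees in higher clusters, and the labels occurring in its own cluster (`colour_lift`).
Edges leaving the cluster then lift to edges. For edges inside it, the label includes the residues
modulo `N` of path lengths from a base point of the cluster; equal residue sets allow an edge to be
imitated modulo `N` (`clusterLifts_residues`).

Finally, relations and truth tables are coded by binary digits of numbers, so that the search for a
bounded countermodel is primitive recursive (`mem_log_iff`, `isDecidable_log`). -/

theorem relPow_add {W : Type u} {R : W → W → Prop} {i j : ℕ} {x y z : W}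
    (h₁ : relPow R i x y) (h₂ : relPow R j y z) : relPow R (i + j) x z := by
  induction j generalizing z with
  | zero => cases h₂; exact h₁
  | succ j ih =>
    obtain ⟨w, hw, hz⟩ := h₂
    exact ⟨w, ih hw, hz⟩

theorem relPow_split {W : Type u} {R : W → W → Prop} {i j : ℕ} {x z : W}
    (h : relPow R (i + j) x z) : ∃ y, relPow R i x y ∧ relPow R j y z := by
  induction j generalizing z with
  | zero => exact ⟨z, h, rfl⟩
  | succ j ih =>
    obtain ⟨w, hw, hz⟩ := h
    obtain ⟨y, h₁, h₂⟩ := ih hw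
    exact ⟨y, h₁, w, h₂, hz⟩

theorem relPow_one {W : Type u} {R : W → W → Prop} {x y : W} (h : R x y) : relPow R 1 x y :=
  ⟨x, rfl, h⟩

theorem relPow_mul {W : Type u} {R : W → W → Prop} {i : ℕ} {x : W} (h : relPow R i x x) (k : ℕ) :
    relPow R (k * i) x x := by
  induction k with
  | zero => simp [relPow]
  | succ k ih => rw [Nat.succ_mul]; exact relPow_add ih h

theorem Frame.star_iff {F : Frame.{u}} {x y : F.W} : F.Star x y ↔ ∃ i, relPow F.R i x y := by
  constructor
  · intro h
    induction h with
    | refl => exact ⟨0, rfl⟩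
    | tail _ hR ih =>
      obtain ⟨i, hi⟩ := ih
      exact ⟨i + 1, _, hi, hR⟩
  · rintro ⟨i, hi⟩
    induction i generalizing y with
    | zero => cases hi; exact Relation.ReflTransGen.refl
    | succ i ih =>
      obtain ⟨z, hz, hR⟩ := hi
      exact (ih hz).tail hR

/-- In an `(m, n)`-frame, paths can be shortened by multiples of `n - m`, as long as their
length stays at least `m`. -/
theorem relPow_shorten {F : Frame.{u}} {m n : ℕ} (hmn : m ≤ n) (hF : F ∈ classF m n) (k : ℕ)
    {x y : F.W} (h : relPow F.R (m + k * (n - m)) x y) : relPow F.R m x y := by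
  induction k generalizing y with
  | zero => simpa using h
  | succ k ih =>
    -- One copy of `n - m` completes the initial segment to length `n`, which the inclusion replaces
    -- by length `m`.
    rw [show m + (k + 1) * (n - m) = n + k * (n - m) by rw [Nat.succ_mul]; omega] at h
    obtain ⟨z, h₁, h₂⟩ := relPow_split h
    exact ih (relPow_add (hF _ _ h₁) h₂)

/-- Replacing an initial segment of length `n` by one of length `m < n` strictly shortens a path.
This bounds the paths to be inspected when the height of a finite frame is computed. -/
theorem classF_subset_classG {m n : ℕ} (hmn : m < n) : classF.{u} m n ⊆ classG n := by
  intro F hF x y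
  rw [Frame.star_iff]
  refine ⟨?_, fun ⟨i, _, hi⟩ => ⟨i, hi⟩⟩
  rintro ⟨i, hi⟩
  induction i using Nat.strong_induction_on with
  | _ i ih =>
    by_cases h : i ≤ n
    · exact ⟨i, h, hi⟩
    · obtain ⟨j, rfl⟩ := Nat.exists_eq_add_of_le (not_le.1 h).le
      obtain ⟨z, h₁, h₂⟩ := relPow_split hi
      exact ih (m + j) (by omega) (relPow_add (hF _ _ h₁) h₂)

/-- Collapsing paths of length `m + 1` suffices, by induction along the path; the condition becomes
checkable in a finite frame. -/
theorem mem_classG_iff {m : ℕ} {F : Frame.{u}} :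
    F ∈ classG m ↔ ∀ x y, relPow F.R (m + 1) x y → ∃ i ≤ m, relPow F.R i x y := by
  constructor
  · exact fun h x y hxy => (h x y).1 (Frame.star_iff.2 ⟨_, hxy⟩)
  · intro h x y
    refine ⟨fun hxy => ?_, fun ⟨i, _, hi⟩ => Frame.star_iff.2 ⟨i, hi⟩⟩
    induction hxy with
    | refl => exact ⟨0, Nat.zero_le _, rfl⟩
    | tail _ hR ih =>
      obtain ⟨i, hi, hxi⟩ := ih
      rcases hi.lt_or_eq with hi | rfl
      · exact ⟨i + 1, hi, _, hxi, hR⟩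
      · exact h _ _ ⟨_, hxi, hR⟩

/-! ### Height -/

/-- There is a strictly increasing sequence of `k` further clusters above the cluster of `x`. -/
def Frame.StrictAbove (F : Frame.{u}) : ℕ → F.W → Prop
  | 0, _ => True
  | k + 1, x => ∃ y, F.Star x y ∧ ¬ F.Star y x ∧ F.StrictAbove k y

theorem Frame.StrictAbove.of_star {F : Frame.{u}} {k : ℕ} {x y : F.W} (hxy : F.Star x y)
    (h : F.StrictAbove k y) : F.StrictAbove k x := by
  cases k with
  | zero => trivial
  | succ k =>
    obtain ⟨z, h₁, h₂, h₃⟩ := h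
    exact ⟨z, hxy.trans h₁, fun h => h₂ (h.trans hxy), h₃⟩

/-- The cluster of a point. -/
def Frame.cluster (F : Frame.{u}) (x : F.W) : F.Skeleton :=
  Quotient.mk F.clusterSetoid x

theorem Frame.exists_cluster (F : Frame.{u}) (c : F.Skeleton) : ∃ x, F.cluster x = c :=
  Quotient.exists_rep c

theorem Frame.StrictAbove.exists_chain {F : Frame.{u}} {k : ℕ} {x : F.W}
    (h : F.StrictAbove k x) : ∃ C : Set F.Skeleton, IsChain (· ≤ ·) C ∧ C.encard = k + 1 ∧
      ∀ c ∈ C, F.cluster x ≤ c := by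
  induction k generalizing x with
  | zero => exact ⟨{F.cluster x}, by simp [IsChain], by simp, by simp⟩
  | succ k ih =>
    obtain ⟨y, h₁, h₂, h₃⟩ := h
    obtain ⟨C, hC, hcard, hle⟩ := ih h₃
    have hxy : F.cluster x ≤ F.cluster y := h₁
    refine ⟨insert (F.cluster x) C, ?_, ?_, ?_⟩
    · exact hC.insert fun c hc _ => Or.inl (hxy.trans (hle c hc))
    · rw [Set.encard_insert_of_notMem, hcard]
      · push_cast; rfl
      · exact fun hx => h₂ (hle _ hx)
    · rintro c (rfl | hc)
      · exact le_rfl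
      · exact hxy.trans (hle c hc)

theorem Frame.exists_strictAbove {F : Frame.{u}} {k : ℕ} {C : Finset F.Skeleton}
    (hC : IsChain (· ≤ ·) (C : Set F.Skeleton)) (hcard : C.card = k + 1) :
    ∃ x, F.cluster x ∈ C ∧ F.StrictAbove k x := by
  classical
  induction k generalizing C with
  | zero =>
    obtain ⟨c, hc⟩ := Finset.card_pos.1 (by omega : 0 < C.card)
    obtain ⟨x, rfl⟩ := F.exists_cluster c
    exact ⟨x, hc, trivial⟩
  | succ k ih =>
    -- In a chain a minimal cluster lies strictly below all the others, so it extends the sequence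
    -- found in the rest.
    obtain ⟨a, ha⟩ := C.exists_minimal (Finset.card_pos.1 (by omega))
    obtain ⟨y, hy, hk⟩ := ih (C := C.erase a) (hC.mono (by simp))
      (by rw [Finset.card_erase_of_mem ha.1, hcard]; rfl)
    have hy' := Finset.mem_erase.1 hy
    obtain ⟨x, rfl⟩ := F.exists_cluster a
    have hle : F.cluster x ≤ F.cluster y := by
      rcases hC ha.1 hy'.2 (Ne.symm hy'.1) with h | h
      · exact h
      · exact ha.2 hy'.2 h
    exact ⟨x, ha.1, y, hle, fun h => hy'.1 (le_antisymm h hle), hk⟩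

/-- This replaces chains in the skeleton by a recursive condition on points, which can be lifted
along quotients and tested by bounded search. -/
theorem Frame.heightLE_iff {F : Frame.{u}} {h : ℕ} :
    F.HeightLE h ↔ ∀ x, ¬ F.StrictAbove h x := by
  classical
  constructor
  · rintro ⟨k, hk, -, hmax⟩ x hx
    obtain ⟨C, hC, hcard, -⟩ := hx.exists_chain
    have := hmax C hC
    rw [hcard] at this
    have : h + 1 ≤ k := by exact_mod_cast this
    omega
  · intro hF
    have hle : ∀ C : Set F.Skeleton, IsChain (· ≤ ·) C → C.encard ≤ h := by
      intro C hC
      by_contra hlt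
      obtain ⟨D, hD, hcard⟩ := Set.exists_subset_encard_eq
        (Order.add_one_le_of_lt (not_le.1 hlt))
      have hfin : D.Finite := Set.finite_of_encard_eq_coe (k := h + 1) (by rw [hcard]; rfl)
      obtain ⟨D, rfl⟩ := hfin.exists_finset_coe
      obtain ⟨x, -, hx⟩ := F.exists_strictAbove (k := h) (hC.mono hD)
        (by rw [Set.encard_coe_eq_coe_finsetCard] at hcard; exact_mod_cast hcard)
      exact hF x hx
    -- The height is the largest chain cardinality attained up to `h`; the empty chain ensures that
    -- there is one.
    let P : ℕ → Prop := fun k => ∃ C : Set F.Skeleton, IsChain (· ≤ ·) C ∧ C.encard = k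
    have h0 : P 0 := ⟨∅, by simp [IsChain], by simp⟩
    refine ⟨Nat.findGreatest P h, Nat.findGreatest_le h,
      Nat.findGreatest_spec (Nat.zero_le h) h0, fun C hC => ?_⟩
    have hCh := hle C hC
    obtain ⟨k, hk⟩ := ENat.ne_top_iff_exists.1 (ne_top_of_le_ne_top (ENat.natCast_ne_top h) hCh)
    rw [← hk] at hCh ⊢
    exact_mod_cast Nat.le_findGreatest (P := P) (by exact_mod_cast hCh) ⟨C, hC, hk.symm⟩

/-! ### Quotients -/

/-- The map `g` is onto, and the relation of `G` is the least one making `g` a homomorphism. -/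
structure IsMinQuotient (F G : Frame.{u}) (g : F.W → G.W) : Prop where
  surj : Function.Surjective g
  rel_iff : ∀ u v, G.R u v ↔ ∃ x y, g x = u ∧ g y = v ∧ F.R x y

/-- Whenever a point of the fibre of `g x` sees `y'`, there is a nontrivial path from `x` to the
fibre of `g y'` of length `1` modulo `N`. -/
def LiftsMod {W : Type u} (R : W → W → Prop) (N : ℕ) {V : Type*} (g : W → V) : Prop :=
  ∀ x x' y', g x = g x' → R x' y' →
    ∃ y L, g y = g y' ∧ relPow R L x y ∧ 1 ≤ L ∧ (L : ZMod N) = 1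

theorem IsMinQuotient.relPow {F G : Frame.{u}} {g : F.W → G.W} (hg : IsMinQuotient F G g) {i : ℕ}
    {x y : F.W} (h : relPow F.R i x y) : relPow G.R i (g x) (g y) := by
  induction i generalizing y with
  | zero => cases h; rfl
  | succ i ih =>
    obtain ⟨z, hz, hR⟩ := h
    exact ⟨g z, ih hz, (hg.rel_iff _ _).2 ⟨z, y, rfl, rfl, hR⟩⟩

/-- An edge of `G` comes from an edge of `F` that may start elsewhere in the fibre; `LiftsMod`
transfers it to the point already reached. Each piece has positive length, hence `i ≤ L`. -/
theorem IsMinQuotient.lift {F G : Frame.{u}} {g : F.W → G.W} (hg : IsMinQuotient F G g) {N : ℕ}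
    (hl : LiftsMod F.R N g) {i : ℕ} {x : F.W} {v : G.W} (h : ModalLogic.relPow G.R i (g x) v) :
    ∃ y L, g y = v ∧ ModalLogic.relPow F.R L x y ∧ i ≤ L ∧ (L : ZMod N) = i := by
  induction i generalizing v with
  | zero => exact ⟨x, 0, h, rfl, le_rfl, rfl⟩
  | succ i ih =>
    obtain ⟨w, hw, hR⟩ := h
    obtain ⟨z, L, rfl, hz, hiL, hL⟩ := ih hw
    obtain ⟨z', y', hz', rfl, hR'⟩ := (hg.rel_iff _ _).1 hR
    obtain ⟨y, L', hy, hzy, h1, hL'⟩ := hl z z' y' hz'.symm hR'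
    exact ⟨y, L + L', hy, relPow_add hz hzy, by omega, by push_cast; rw [hL, hL']⟩

theorem IsMinQuotient.mem_classF {F G : Frame.{u}} {g : F.W → G.W} (hg : IsMinQuotient F G g)
    {m n : ℕ} (hmn : m < n) (hl : LiftsMod F.R (n - m) g) (hF : F ∈ classF m n) :
    G ∈ classF m n := by
  intro u v huv
  obtain ⟨x, rfl⟩ := hg.surj u
  obtain ⟨y, L, rfl, hxy, hnL, hL⟩ := hg.lift hl huv
  refine hg.relPow ?_
  have hmod : m ≡ L [MOD (n - m)] := by
    rw [ZMod.natCast_eq_natCast_iff] at hL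
    refine Nat.ModEq.trans ?_ hL.symm
    exact (Nat.modEq_iff_dvd' hmn.le).2 dvd_rfl
  obtain ⟨k, hk⟩ := (Nat.modEq_iff_dvd' (by omega)).1 hmod
  refine relPow_shorten hmn.le hF k ?_
  rwa [mul_comm, ← hk, Nat.add_sub_cancel' (by omega)]

theorem IsMinQuotient.lift_star {F G : Frame.{u}} {g : F.W → G.W} (hg : IsMinQuotient F G g)
    {N : ℕ} (hl : LiftsMod F.R N g) {x : F.W} {v : G.W} (h : G.Star (g x) v) :
    ∃ y, g y = v ∧ F.Star x y := by
  obtain ⟨i, hi⟩ := Frame.star_iff.1 h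
  obtain ⟨y, L, hy, hxy, -⟩ := hg.lift hl hi
  exact ⟨y, hy, Frame.star_iff.2 ⟨L, hxy⟩⟩

theorem IsMinQuotient.mem_classG {F G : Frame.{u}} {g : F.W → G.W} (hg : IsMinQuotient F G g)
    {m N : ℕ} (hl : LiftsMod F.R N g) (hF : F ∈ classG m) : G ∈ classG m := by
  intro u v
  refine ⟨fun huv => ?_, fun ⟨i, _, hi⟩ => Frame.star_iff.2 ⟨i, hi⟩⟩
  obtain ⟨x, rfl⟩ := hg.surj u
  obtain ⟨y, rfl, hxy⟩ := hg.lift_star hl huv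
  obtain ⟨i, hi, h⟩ := (hF x y).1 hxy
  exact ⟨i, hi, hg.relPow h⟩

theorem IsMinQuotient.strictAbove {F G : Frame.{u}} {g : F.W → G.W} (hg : IsMinQuotient F G g)
    {N : ℕ} (hl : LiftsMod F.R N g) {k : ℕ} {x : F.W} (h : G.StrictAbove k (g x)) :
    F.StrictAbove k x := by
  induction k generalizing x with
  | zero => trivial
  | succ k ih =>
    obtain ⟨v, h₁, h₂, h₃⟩ := h
    obtain ⟨y, rfl, hxy⟩ := hg.lift_star hl h₁
    refine ⟨y, hxy, fun hyx => h₂ ?_, ih h₃⟩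
    obtain ⟨i, hi⟩ := Frame.star_iff.1 hyx
    exact Frame.star_iff.2 ⟨i, hg.relPow hi⟩

theorem IsMinQuotient.heightLE {F G : Frame.{u}} {g : F.W → G.W} (hg : IsMinQuotient F G g)
    {N h : ℕ} (hl : LiftsMod F.R N g) (hF : F.HeightLE h) : G.HeightLE h := by
  rw [Frame.heightLE_iff] at hF ⊢
  intro u hu
  obtain ⟨x, rfl⟩ := hg.surj u
  exact hF x (hg.strictAbove hl hu)

/-! ### Finite colourings of frames of finite height -/

/-- The colours of points over a set `A` of basic labels, for points with fewer than `k`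
strict levels above them. -/
def Colour (A : Type) : ℕ → Type
  | 0 => Unit
  | k + 1 => Colour A k ⊕ (A × Set (Colour A k)) × Set (A × Set (Colour A k))

/-- The number of colours over a set of `K` basic labels. -/
def colourCount (K : ℕ) : ℕ → ℕ
  | 0 => 1
  | k + 1 => colourCount K k + K * 2 ^ colourCount K k * 2 ^ (K * 2 ^ colourCount K k)

theorem finite_colour (A : Type) [Finite A] (k : ℕ) : Finite (Colour A k) := by
  induction k with
  | zero => exact inferInstanceAs (Finite Unit)
  | succ k ih =>
    exact inferInstanceAs
      (Finite (Colour A k ⊕ (A × Set (Colour A k)) × Set (A × Set (Colour A k))))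

theorem natCard_set (A : Type) [Finite A] : Nat.card (Set A) = 2 ^ Nat.card A := by
  have := Fintype.ofFinite A
  rw [Nat.card_eq_fintype_card, Nat.card_eq_fintype_card, Fintype.card_set]

theorem card_colour (A : Type) [Finite A] (k : ℕ) :
    Nat.card (Colour A k) = colourCount (Nat.card A) k := by
  induction k with
  | zero => exact Nat.card_unique (α := Unit)
  | succ k ih =>
    have := finite_colour A k
    rw [colourCount, ← ih]
    refine (Nat.card_sum (α := Colour A k)
      (β := (A × Set (Colour A k)) × Set (A × Set (Colour A k)))).trans ?_
    rw [Nat.card_prod, natCard_set, Nat.card_prod, natCard_set]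

variable {F : Frame.{u}} {A : Type}

/-- The basic label of a point, with the colours of the points of smaller depth it sees. -/
def upLabel (F : Frame.{u}) {B : Type} (k : ℕ) (a : F.W → A) (c : F.W → B) (x : F.W) :
    A × Set B :=
  (a x, {b | ∃ y, F.R x y ∧ ¬ F.StrictAbove k y ∧ c y = b})

/-- The colour of a point `x`: the stage at which its depth is exhausted, its label, and the
set of labels occurring in its cluster. -/
noncomputable def colour (F : Frame.{u}) (a : F.W → A) : (k : ℕ) → F.W → Colour A k
  | 0, _ => ()
  | k + 1, x =>
    open Classical in
    if F.StrictAbove k x then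
      Sum.inr (upLabel F k a (colour F a k) x,
        {l | ∃ y, F.Star x y ∧ F.Star y x ∧ upLabel F k a (colour F a k) y = l})
    else Sum.inl (colour F a k x)

theorem colour_of_strictAbove {a : F.W → A} {k : ℕ} {x : F.W} (h : F.StrictAbove k x) :
    colour F a (k + 1) x = Sum.inr (upLabel F k a (colour F a k) x,
      {l | ∃ y, F.Star x y ∧ F.Star y x ∧ upLabel F k a (colour F a k) y = l}) := by
  exact if_pos h

theorem colour_of_not_strictAbove {a : F.W → A} {k : ℕ} {x : F.W} (h : ¬ F.StrictAbove k x) :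
    colour F a (k + 1) x = Sum.inl (colour F a k x) := by
  exact if_neg h

theorem strictAbove_iff_of_colour_eq {a : F.W → A} {k : ℕ} {x y : F.W}
    (h : colour F a (k + 1) x = colour F a (k + 1) y) :
    F.StrictAbove k x ↔ F.StrictAbove k y := by
  by_cases hx : F.StrictAbove k x <;> by_cases hy : F.StrictAbove k y
  · simp [hx, hy]
  · rw [colour_of_strictAbove hx, colour_of_not_strictAbove hy] at h; cases h
  · rw [colour_of_not_strictAbove hx, colour_of_strictAbove hy] at h; cases h
  · simp [hx, hy]

theorem label_eq_of_colour_eq {a : F.W → A} {k : ℕ} {x y : F.W} (hx : ¬ F.StrictAbove k x)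
    (h : colour F a k x = colour F a k y) : a x = a y := by
  induction k with
  | zero => exact absurd trivial hx
  | succ k ih =>
    have hiff := strictAbove_iff_of_colour_eq h
    by_cases hk : F.StrictAbove k x
    · rw [colour_of_strictAbove hk, colour_of_strictAbove (hiff.1 hk)] at h
      exact congrArg (fun p => p.1.1) (Sum.inr.inj h)
    · rw [colour_of_not_strictAbove hk, colour_of_not_strictAbove (mt hiff.2 hk)] at h
      exact ih hk (Sum.inl.inj h)

/-- Arrows inside a cluster are reflected, up to length modulo `N`, in every cluster with the same
labels. -/
def ClusterLifts (F : Frame.{u}) (N : ℕ) (a : F.W → A) : Prop :=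
  ∀ x y x' y', F.Star x y → F.Star y x → F.R x' y' → F.Star y' x' → a x = a x' → a y = a y' →
    ∃ L, relPow F.R L x y ∧ 1 ≤ L ∧ (L : ZMod N) = 1

/-- At the stage where the depth of `x` is exhausted, an edge of `x'` either stays in its cluster,
where `ClusterLifts` imitates it, or leads to a smaller depth, where the label of `x` guarantees an
edge to the same colour. Points of smaller depth are handled by induction. -/
theorem colour_lift {N : ℕ} {a : F.W → A} (ha : ClusterLifts F N a) {k : ℕ} {x x' y' : F.W}
    (hx : ¬ F.StrictAbove k x) (hx' : ¬ F.StrictAbove k x')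
    (h : colour F a k x = colour F a k x') (hR : F.R x' y') :
    ∃ y L, colour F a k y = colour F a k y' ∧ relPow F.R L x y ∧ 1 ≤ L ∧ (L : ZMod N) = 1 := by
  induction k generalizing x x' y' with
  | zero => exact absurd trivial hx
  | succ k ih =>
    by_cases hk : F.StrictAbove k x
    · have hk' := (strictAbove_iff_of_colour_eq h).1 hk
      rw [colour_of_strictAbove hk, colour_of_strictAbove hk'] at h
      obtain ⟨hlab, hset⟩ := Prod.mk.inj (Sum.inr.inj h)
      have hxy' : F.Star x' y' := .single hR
      by_cases hyx' : F.Star y' x'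
      · have hy' : F.StrictAbove k y' := hk'.of_star hyx'
        -- The two clusters realize the same labels, so the cluster of `x` contains a candidate for
        -- the target.
        have hmem : upLabel F k a (colour F a k) y' ∈
            {l | ∃ y, F.Star x y ∧ F.Star y x ∧ upLabel F k a (colour F a k) y = l} := by
          rw [hset]; exact ⟨y', hxy', hyx', rfl⟩
        obtain ⟨y, hxy, hyx, hl⟩ := hmem
        have hy : F.StrictAbove k y := hk.of_star hyx
        obtain ⟨L, hL⟩ := ha x y x' y' hxy hyx hR hyx' (congrArg Prod.fst hlab)
          (congrArg Prod.fst hl)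
        refine ⟨y, L, ?_, hL⟩
        rw [colour_of_strictAbove hy, colour_of_strictAbove hy', hl]
        -- The set of labels depends only on the cluster, so it passes from `x` to `y` and from `x'`
        -- to `y'`.
        have key : ∀ {p q : F.W}, F.Star p q → F.Star q p →
            {l | ∃ y, F.Star p y ∧ F.Star y p ∧ upLabel F k a (colour F a k) y = l} =
            {l | ∃ y, F.Star q y ∧ F.Star y q ∧ upLabel F k a (colour F a k) y = l} := by
          intro p q hpq hqp
          ext l
          exact ⟨fun ⟨y, h₁, h₂, h₃⟩ => ⟨y, hqp.trans h₁, h₂.trans hpq, h₃⟩,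
            fun ⟨y, h₁, h₂, h₃⟩ => ⟨y, hpq.trans h₁, h₂.trans hqp, h₃⟩⟩
        rw [key hyx hxy, hset, key hxy' hyx']
      -- `y'` lies in a strictly higher cluster; `k` levels above it would give `k + 1` above `x'`.
      · have hy' : ¬ F.StrictAbove k y' := fun hy' => hx' ⟨y', hxy', hyx', hy'⟩
        have hmem : colour F a k y' ∈ (upLabel F k a (colour F a k) x).2 := by
          rw [hlab]; exact ⟨y', hR, hy', rfl⟩
        obtain ⟨y, hxy, hy, hc⟩ := hmem
        refine ⟨y, 1, ?_, relPow_one hxy, le_rfl, Nat.cast_one⟩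
        rw [colour_of_not_strictAbove hy, colour_of_not_strictAbove hy', hc]
    · have hk' := mt (strictAbove_iff_of_colour_eq h).2 hk
      rw [colour_of_not_strictAbove hk, colour_of_not_strictAbove hk'] at h
      obtain ⟨y, L, hc, hL, h1, hN⟩ := ih hk hk' (Sum.inl.inj h) hR
      refine ⟨y, L, ?_, hL, h1, hN⟩
      have hy' : ¬ F.StrictAbove k y' := fun hy => hk' (hy.of_star (.single hR))
      have hy : ¬ F.StrictAbove k y := fun hy => hk (hy.of_star (Frame.star_iff.2 ⟨L, hL⟩))
      rw [colour_of_not_strictAbove hy, colour_of_not_strictAbove hy', hc]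

/-! ### Residues of path lengths within a cluster -/

/-- A point of the cluster of `x` depending only on that cluster. -/
noncomputable def basePoint (F : Frame.{u}) (x : F.W) : F.W :=
  Quotient.out (Quotient.mk F.clusterSetoid x)

theorem basePoint_star (x : F.W) : F.Star (basePoint F x) x ∧ F.Star x (basePoint F x) :=
  Quotient.exact (s := F.clusterSetoid) (Quotient.out_eq (Quotient.mk F.clusterSetoid x))

theorem basePoint_eq {x y : F.W} (h₁ : F.Star x y) (h₂ : F.Star y x) :
    basePoint F x = basePoint F y := by
  have : Quotient.mk F.clusterSetoid x = Quotient.mk F.clusterSetoid y :=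
    Quotient.sound (s := F.clusterSetoid) ⟨h₁, h₂⟩
  rw [basePoint, basePoint, this]

/-- The lengths modulo `N` of the nontrivial paths from the base point of the cluster. -/
def residues (F : Frame.{u}) (N : ℕ) (x : F.W) : Set (ZMod N) :=
  {l | ∃ L : ℕ, 1 ≤ L ∧ relPow F.R L (basePoint F x) x ∧ (L : ZMod N) = l}

/-- If `l` is a residue at `x'`, then `l + 1` is one at `y'`. Equality of labels carries both to `x`
and `y`, whose common base point yields paths of lengths `L ≡ l` to `x` and `L' ≡ l + 1` to `y`.
Going backwards along the first, modulo `N`, and then along the second has length congruent to 1. -/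
theorem clusterLifts_residues {B : Type} (N : ℕ) [NeZero N] (b : F.W → B) :
    ClusterLifts F N fun x => (b x, residues F N x) := by
  intro x y x' y' hxy hyx hR hyx' hax hay
  have hres : residues F N x = residues F N x' := (Prod.mk.inj hax).2
  have hres' : residues F N y = residues F N y' := (Prod.mk.inj hay).2
  have hxy' : F.Star x' y' := .single hR
  obtain ⟨i, hi⟩ := Frame.star_iff.1 (basePoint_star x').1
  obtain ⟨j, hj⟩ := Frame.star_iff.1 hyx'
  -- The detour through `y'` and back makes the path nontrivial even when `i = 0`.
  have hmem : ((i + 1 + j : ℕ) : ZMod N) ∈ residues F N x := by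
    rw [hres]
    exact ⟨_, by omega, relPow_add (relPow_add hi (relPow_one hR)) hj, rfl⟩
  have hmem' : ((i + 1 + j : ℕ) : ZMod N) + 1 ∈ residues F N y := by
    rw [hres']
    refine ⟨i + 1 + j + 1, by omega, ?_, by push_cast; rfl⟩
    rw [← basePoint_eq hxy' hyx']
    exact relPow_add (relPow_add (relPow_add hi (relPow_one hR)) hj) (relPow_one hR)
  obtain ⟨L, -, hL, hLl⟩ := hmem
  obtain ⟨L', hL1', hL', hLl'⟩ := hmem'
  rw [← basePoint_eq hxy hyx] at hL'
  obtain ⟨p, hp⟩ := Frame.star_iff.1 (basePoint_star x).2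
  have hN : 1 ≤ N := NeZero.one_le
  -- With `p` the length of a path from `x` to the base point, `p + L` is the length of a loop at
  -- `x`. Traversing it `N - 1` times contributes `-(p + L)`, so the total is congruent to `L' - L`,
  -- that is, to 1.
  refine ⟨(N - 1) * (p + L) + p + L',
    relPow_add (relPow_add (relPow_mul (relPow_add hp hL) _) hp) hL', by omega, ?_⟩
  push_cast [Nat.cast_sub hN, hLl']
  rw [hLl, ZMod.natCast_self]
  push_cast
  ring

/-- A frame of finite height has a finite colouring that refines a given one and lifts arrows
modulo `N`. -/
theorem exists_colouring {h N : ℕ} [NeZero N] (hF : F.HeightLE h) {B : Type} [Finite B]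
    (b : F.W → B) : ∃ (s : ℕ) (g : F.W → Fin (s + 1)), Function.Surjective g ∧
      s < colourCount (Nat.card B * 2 ^ N) h ∧ LiftsMod F.R N g ∧
      ∀ x y, g x = g y → b x = b y := by
  rw [Frame.heightLE_iff] at hF
  let a : F.W → B × Set (ZMod N) := fun x => (b x, residues F N x)
  have : Finite (ZMod N) := Finite.of_equiv (Fin N) (ZMod.finEquiv N).toEquiv
  have := finite_colour (B × Set (ZMod N)) h
  have hcard : Nat.card (Set.range (colour F a h)) ≤ colourCount (Nat.card B * 2 ^ N) h := by
    have := Finite.card_subtype_le (fun c => c ∈ Set.range (colour F a h))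
    rwa [card_colour, Nat.card_prod, natCard_set, Nat.card_zmod] at this
  have hne : Nonempty (Set.range (colour F a h)) :=
    F.nonempty.map fun x => ⟨_, x, rfl⟩
  obtain ⟨s, hs⟩ := Nat.exists_eq_succ_of_ne_zero
    (Nat.card_pos (α := Set.range (colour F a h))).ne'
  let e : Set.range (colour F a h) ≃ Fin (s + 1) := Finite.equivFinOfCardEq hs
  let g : F.W → Fin (s + 1) := fun x => e ⟨colour F a h x, x, rfl⟩
  have hg : ∀ x y, g x = g y ↔ colour F a h x = colour F a h y := fun x y =>
    e.apply_eq_iff_eq.trans Subtype.mk_eq_mk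
  refine ⟨s, g, ?_, by omega, ?_, ?_⟩
  · intro i
    obtain ⟨⟨_, x, rfl⟩, rfl⟩ := e.surjective i
    exact ⟨x, rfl⟩
  · intro x x' y' hx hR
    simp only [hg] at hx ⊢
    exact colour_lift (clusterLifts_residues N b) (hF x) (hF x') hx hR
  · intro x y hxy
    exact congrArg Prod.fst (label_eq_of_colour_eq (hF x) ((hg x y).1 hxy))

/-! ### Primitive recursive predicates -/

theorem primrecPred_imp {α : Type} [Primcodable α] {p q : α → Prop} (hp : PrimrecPred p)
    (hq : PrimrecPred q) : PrimrecPred fun a => p a → q a :=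
  (hp.not.or hq).of_eq fun _ => imp_iff_not_or.symm

theorem primrecPred_iff {α : Type} [Primcodable α] {p q : α → Prop} (hp : PrimrecPred p)
    (hq : PrimrecPred q) : PrimrecPred fun a => p a ↔ q a :=
  ((primrecPred_imp hp hq).and (primrecPred_imp hq hp)).of_eq fun _ => iff_def.symm

theorem primrecPred_exists_lt {α : Type} [Primcodable α] {f : α → ℕ} {p : α → ℕ → Prop}
    (hf : Primrec f) (hp : PrimrecPred fun q : α × ℕ => p q.1 q.2) :
    PrimrecPred fun a => ∃ x < f a, p a x :=
  ((PrimrecRel.exists_mem_list (R := fun x a => p a x)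
    (hp.comp (Primrec.snd.pair Primrec.fst))).comp (Primrec.list_range.comp hf)
      Primrec.id).of_eq fun a => by simp

theorem primrecPred_forall_lt {α : Type} [Primcodable α] {f : α → ℕ} {p : α → ℕ → Prop}
    (hf : Primrec f) (hp : PrimrecPred fun q : α × ℕ => p q.1 q.2) :
    PrimrecPred fun a => ∀ x < f a, p a x :=
  ((PrimrecRel.forall_mem_list (R := fun x a => p a x)
    (hp.comp (Primrec.snd.pair Primrec.fst))).comp (Primrec.list_range.comp hf)
      Primrec.id).of_eq fun a => by simp

theorem primrec_pow : Primrec₂ ((· ^ ·) : ℕ → ℕ → ℕ) :=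
  Primrec₂.unpaired'.1 Nat.Primrec.pow

theorem primrecPred_testBit {α : Type} [Primcodable α] {f g : α → ℕ} (hf : Primrec f)
    (hg : Primrec g) : PrimrecPred fun a => (f a).testBit (g a) = true :=
  (Primrec.eq.comp (Primrec.nat_mod.comp
    (Primrec.nat_div.comp hf (primrec_pow.comp (.const 2) hg)) (.const 2)) (.const 1)).of_eq
    fun a => by simp [Nat.testBit_eq_decide_div_mod_eq]

/-! ### Frames and truth tables coded by numbers -/

/-- The relation on the numbers below `s + 1` coded by the binary digits of `r`. -/
def EdgeBit (s r w v : ℕ) : Prop := r.testBit (w * (s + 1) + v) = true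

/-- The frame with `s + 1` points whose relation is coded by the binary digits of `r`. -/
def bitFrame (s r : ℕ) : Frame.{u} where
  W := ULift (Fin (s + 1))
  nonempty := ⟨⟨0⟩⟩
  R w v := EdgeBit s r w.down v.down

/-- `relPow` for the relation coded by `r`. -/
def PowBit (s r : ℕ) : ℕ → ℕ → ℕ → Prop
  | 0, w, v => w = v
  | i + 1, w, v => ∃ z < s + 1, PowBit s r i w z ∧ EdgeBit s r z v

theorem powBit_iff {s r i : ℕ} {w v : (bitFrame.{u} s r).W} :
    PowBit s r i w.down v.down ↔ relPow (bitFrame.{u} s r).R i w v := by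
  induction i generalizing v with
  | zero =>
    exact Fin.val_inj.trans ULift.down_inj
  | succ i ih =>
    constructor
    · rintro ⟨z, hz, h₁, h₂⟩
      exact ⟨⟨⟨z, hz⟩⟩, ih.1 h₁, h₂⟩
    · rintro ⟨z, h₁, h₂⟩
      exact ⟨z.down, z.down.2, ih.2 h₁, h₂⟩

theorem bitFrame_forall {s r : ℕ} {p : ℕ → Prop} :
    (∀ w : (bitFrame.{u} s r).W, p w.down) ↔ ∀ w < s + 1, p w :=
  ⟨fun h w hw => h ⟨⟨w, hw⟩⟩, fun h w => h w.down w.down.2⟩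

theorem bitFrame_exists {s r : ℕ} {p : ℕ → Prop} :
    (∃ w : (bitFrame.{u} s r).W, p w.down) ↔ ∃ w < s + 1, p w :=
  ⟨fun ⟨w, h⟩ => ⟨w.down, w.down.2, h⟩, fun ⟨w, hw, h⟩ => ⟨⟨⟨w, hw⟩⟩, h⟩⟩

/-- `StrictAbove` for the relation coded by `r`, with paths of length at most `q`. -/
def StrictAboveBit (s r q : ℕ) : ℕ → ℕ → Prop
  | 0, _ => True
  | k + 1, w => ∃ v < s + 1, (∃ i < q + 1, PowBit s r i w v) ∧
      ¬ (∃ i < q + 1, PowBit s r i v w) ∧ StrictAboveBit s r q k v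

theorem strictAboveBit_iff {s r q k : ℕ} (hG : bitFrame.{u} s r ∈ classG q)
    {w : (bitFrame.{u} s r).W} :
    StrictAboveBit s r q k w.down ↔ (bitFrame.{u} s r).StrictAbove k w := by
  have hstar : ∀ w v : (bitFrame.{u} s r).W,
      (∃ i < q + 1, PowBit s r i w.down v.down) ↔ (bitFrame.{u} s r).Star w v := by
    intro w v
    rw [hG w v]
    simp only [powBit_iff, Nat.lt_succ_iff]
  induction k generalizing w with
  | zero => exact Iff.rfl
  | succ k ih =>
    constructor
    · rintro ⟨v, hv, h₁, h₂, h₃⟩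
      exact ⟨⟨⟨v, hv⟩⟩, (hstar w ⟨⟨v, hv⟩⟩).1 h₁, mt (hstar ⟨⟨v, hv⟩⟩ w).2 h₂,
        (ih (w := ⟨⟨v, hv⟩⟩)).1 h₃⟩
    · rintro ⟨v, h₁, h₂, h₃⟩
      exact ⟨v.down, v.down.2, (hstar w v).2 h₁, mt (hstar v w).1 h₂, ih.2 h₃⟩

theorem bitFrame_mem_classF {m n s r : ℕ} : bitFrame.{u} s r ∈ classF m n ↔
    ∀ w < s + 1, ∀ v < s + 1, PowBit s r n w v → PowBit s r m w v := by
  rw [← bitFrame_forall.{u} (r := r)]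
  refine forall_congr' fun w => ?_
  rw [← bitFrame_forall.{u} (r := r)]
  exact forall_congr' fun v => by rw [powBit_iff, powBit_iff]

theorem bitFrame_mem_classG {m s r : ℕ} : bitFrame.{u} s r ∈ classG m ↔
    ∀ w < s + 1, ∀ v < s + 1, PowBit s r (m + 1) w v → ∃ i < m + 1, PowBit s r i w v := by
  rw [mem_classG_iff, ← bitFrame_forall.{u} (r := r)]
  refine forall_congr' fun w => ?_
  rw [← bitFrame_forall.{u} (r := r)]
  exact forall_congr' fun v => by simp only [powBit_iff, Nat.lt_succ_iff]

/-- Transitivity with bound `q` lets paths of length at most `q` stand for `R*`. -/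
theorem bitFrame_heightLE {s r q h : ℕ} (hG : bitFrame.{u} s r ∈ classG q) :
    (bitFrame.{u} s r).HeightLE h ↔ ∀ w < s + 1, ¬ StrictAboveBit s r q h w := by
  rw [Frame.heightLE_iff, ← bitFrame_forall.{u} (r := r)]
  exact forall_congr' fun w => by rw [strictAboveBit_iff hG]

section Primrec

variable {α : Type} [Primcodable α] {s r w v : α → ℕ}

theorem primrecPred_edgeBit (hs : Primrec s) (hr : Primrec r) (hw : Primrec w) (hv : Primrec v) :
    PrimrecPred fun a => EdgeBit (s a) (r a) (w a) (v a) :=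
  primrecPred_testBit hr (Primrec.nat_add.comp (Primrec.nat_mul.comp hw (Primrec.succ.comp hs)) hv)

/-- The exponent is fixed, so each level merely adds one bounded quantifier. The domain `α` varies
in the induction because the quantifier adds a coordinate. -/
theorem primrecPred_powBit (i : ℕ) {α : Type} [Primcodable α] {s r w v : α → ℕ} (hs : Primrec s)
    (hr : Primrec r) (hw : Primrec w) (hv : Primrec v) :
    PrimrecPred fun a => PowBit (s a) (r a) i (w a) (v a) := by
  induction i generalizing α with
  | zero => exact Primrec.eq.comp hw hv
  | succ i ih =>
    exact primrecPred_exists_lt (Primrec.succ.comp hs)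
      ((ih (hs.comp .fst) (hr.comp .fst) (hw.comp .fst) .snd).and
        (primrecPred_edgeBit (hs.comp .fst) (hr.comp .fst) .snd (hv.comp .fst)))

theorem primrecPred_exists_powBit (q : ℕ) (hs : Primrec s) (hr : Primrec r) (hw : Primrec w)
    (hv : Primrec v) : PrimrecPred fun a => ∃ i < q, PowBit (s a) (r a) i (w a) (v a) := by
  induction q with
  | zero =>
    exact (PrimrecPred.not (Primrec.eq.comp (Primrec.const 0) (Primrec.const 0))).of_eq (by simp)
  | succ q ih =>
    exact (ih.or (primrecPred_powBit q hs hr hw hv)).of_eq fun a => by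
      simp only [Nat.exists_lt_succ_right]

theorem primrecPred_strictAboveBit (q k : ℕ) {α : Type} [Primcodable α] {s r w : α → ℕ}
    (hs : Primrec s) (hr : Primrec r) (hw : Primrec w) :
    PrimrecPred fun a => StrictAboveBit (s a) (r a) q k (w a) := by
  induction k generalizing α with
  | zero =>
    exact (Primrec.eq.comp (Primrec.const 0) (Primrec.const 0)).of_eq (by simp [StrictAboveBit])
  | succ k ih =>
    have hs' : Primrec fun p : α × ℕ => s p.1 := hs.comp .fst
    have hr' : Primrec fun p : α × ℕ => r p.1 := hr.comp .fst
    have hw' : Primrec fun p : α × ℕ => w p.1 := hw.comp .fst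
    exact primrecPred_exists_lt (Primrec.succ.comp hs)
      ((primrecPred_exists_powBit (q + 1) hs' hr' hw' .snd).and
        ((primrecPred_exists_powBit (q + 1) hs' hr' .snd hw').not.and (ih hs' hr' .snd)))

theorem primrecPred_heightBit (q h : ℕ) (hs : Primrec s) (hr : Primrec r) :
    PrimrecPred fun a => ∀ w < s a + 1, ¬ StrictAboveBit (s a) (r a) q h w :=
  primrecPred_forall_lt (Primrec.succ.comp hs)
    (primrecPred_strictAboveBit q h (hs.comp .fst) (hr.comp .fst) .snd).not

theorem primrecRel_bitFrame_mem_classFH {m n h : ℕ} (hmn : m < n) :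
    PrimrecRel fun s r => bitFrame.{u} s r ∈ classFH m n h := by
  have hs : Primrec fun p : ((ℕ × ℕ) × ℕ) × ℕ => p.1.1.1 := .comp .fst (.comp .fst .fst)
  have hr : Primrec fun p : ((ℕ × ℕ) × ℕ) × ℕ => p.1.1.2 := .comp .snd (.comp .fst .fst)
  have hw : Primrec fun p : ((ℕ × ℕ) × ℕ) × ℕ => p.1.2 := .comp .snd .fst
  have hF : PrimrecPred fun p : ℕ × ℕ => bitFrame.{u} p.1 p.2 ∈ classF m n :=
    (primrecPred_forall_lt (Primrec.succ.comp .fst) (primrecPred_forall_lt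
      (Primrec.succ.comp (Primrec.fst.comp .fst)) (primrecPred_imp
        (primrecPred_powBit n hs hr hw .snd) (primrecPred_powBit m hs hr hw .snd)))).of_eq
      fun p => bitFrame_mem_classF.symm
  refine (hF.and (primrecPred_heightBit n h Primrec.fst Primrec.snd)).of_eq fun p => ?_
  exact and_congr_right fun hp => (bitFrame_heightLE (classF_subset_classG hmn hp)).symm

theorem primrecRel_bitFrame_mem_classGH {m h : ℕ} :
    PrimrecRel fun s r => bitFrame.{u} s r ∈ classGH m h := by
  have hs : Primrec fun p : ((ℕ × ℕ) × ℕ) × ℕ => p.1.1.1 := .comp .fst (.comp .fst .fst)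
  have hr : Primrec fun p : ((ℕ × ℕ) × ℕ) × ℕ => p.1.1.2 := .comp .snd (.comp .fst .fst)
  have hw : Primrec fun p : ((ℕ × ℕ) × ℕ) × ℕ => p.1.2 := .comp .snd .fst
  have hG : PrimrecPred fun p : ℕ × ℕ => bitFrame.{u} p.1 p.2 ∈ classG m :=
    (primrecPred_forall_lt (Primrec.succ.comp .fst) (primrecPred_forall_lt
      (Primrec.succ.comp (Primrec.fst.comp .fst)) (primrecPred_imp
        (primrecPred_powBit (m + 1) hs hr hw .snd)
        (primrecPred_exists_powBit (m + 1) hs hr hw .snd)))).of_eq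
      fun p => bitFrame_mem_classG.symm
  refine (hG.and (primrecPred_heightBit m h Primrec.fst Primrec.snd)).of_eq fun p => ?_
  exact and_congr_right fun hp => (bitFrame_heightLE hp).symm

theorem primrec_colourCount {K : α → ℕ} (hK : Primrec K) (k : ℕ) :
    Primrec fun a => colourCount (K a) k := by
  induction k with
  | zero => exact .const 1
  | succ k ih =>
    have h : Primrec fun a => K a * 2 ^ colourCount (K a) k :=
      Primrec.nat_mul.comp hK (primrec_pow.comp (.const 2) ih)
    exact Primrec.nat_add.comp ih (Primrec.nat_mul.comp h (primrec_pow.comp (.const 2) h))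

end Primrec

/-- The entry of the truth table `t` for the formula with Gödel number `e` at the point `w`. -/
def TableBit (s t e w : ℕ) : Prop := t.testBit (e * (s + 1) + w) = true

/-- The truth table `t` obeys the semantic clause of the formula with Gödel number `e` at `w`. -/
def TableRule (s r t e w : ℕ) : Prop :=
  (e = 0 → ¬ TableBit s t e w) ∧ (e = 1 → TableBit s t e w) ∧ (1 < e →
    ((e - 2) % 7 = 1 → (TableBit s t e w ↔ ¬ TableBit s t ((e - 2) / 7) w)) ∧
    ((e - 2) % 7 = 2 → (TableBit s t e w ↔
      ∃ v < s + 1, EdgeBit s r w v ∧ TableBit s t ((e - 2) / 7) v)) ∧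
    ((e - 2) % 7 = 3 → (TableBit s t e w ↔ (TableBit s t ((e - 2) / 7).unpair.1 w ∧
      TableBit s t ((e - 2) / 7).unpair.2 w))) ∧
    ((e - 2) % 7 = 4 → (TableBit s t e w ↔ (TableBit s t ((e - 2) / 7).unpair.1 w ∨
      TableBit s t ((e - 2) / 7).unpair.2 w))) ∧
    ((e - 2) % 7 = 5 → (TableBit s t e w ↔ (TableBit s t ((e - 2) / 7).unpair.1 w →
      TableBit s t ((e - 2) / 7).unpair.2 w))) ∧
    ((e - 2) % 7 = 6 → (TableBit s t e w ↔ (TableBit s t ((e - 2) / 7).unpair.1 w ↔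
      TableBit s t ((e - 2) / 7).unpair.2 w))))

theorem primrecPred_tableBit {α : Type} [Primcodable α] {s t e w : α → ℕ} (hs : Primrec s)
    (ht : Primrec t) (he : Primrec e) (hw : Primrec w) :
    PrimrecPred fun a => TableBit (s a) (t a) (e a) (w a) :=
  primrecPred_testBit ht (Primrec.nat_add.comp (Primrec.nat_mul.comp he (Primrec.succ.comp hs)) hw)

theorem primrecPred_tableRule {α : Type} [Primcodable α] {s r t e w : α → ℕ} (hs : Primrec s)
    (hr : Primrec r) (ht : Primrec t) (he : Primrec e) (hw : Primrec w) :
    PrimrecPred fun a => TableRule (s a) (r a) (t a) (e a) (w a) := by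
  have he2 : Primrec fun a => e a - 2 := Primrec.nat_sub.comp he (.const 2)
  have hd : Primrec fun a => (e a - 2) / 7 := Primrec.nat_div.comp he2 (.const 7)
  have hl : Primrec fun a => ((e a - 2) / 7).unpair.1 := .comp .fst (.comp .unpair hd)
  have hrt : Primrec fun a => ((e a - 2) / 7).unpair.2 := .comp .snd (.comp .unpair hd)
  have hmod : ∀ k, PrimrecPred fun a => (e a - 2) % 7 = k := fun k =>
    Primrec.eq.comp (Primrec.nat_mod.comp he2 (.const 7)) (.const k)
  have hT := primrecPred_tableBit hs ht he hw
  have hD := primrecPred_tableBit hs ht hd hw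
  have hL := primrecPred_tableBit hs ht hl hw
  have hR := primrecPred_tableBit hs ht hrt hw
  have hE : PrimrecPred fun a => ∃ v < s a + 1, EdgeBit (s a) (r a) (w a) v ∧
      TableBit (s a) (t a) ((e a - 2) / 7) v :=
    primrecPred_exists_lt (Primrec.succ.comp hs)
      ((primrecPred_edgeBit (hs.comp .fst) (hr.comp .fst) (hw.comp .fst) .snd).and
        (primrecPred_tableBit (hs.comp .fst) (ht.comp .fst) (hd.comp .fst) .snd))
  exact (primrecPred_imp (Primrec.eq.comp he (.const 0)) hT.not).and
    ((primrecPred_imp (Primrec.eq.comp he (.const 1)) hT).and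
    (primrecPred_imp (Primrec.nat_lt.comp (.const 1) he)
      ((primrecPred_imp (hmod 1) (primrecPred_iff hT hD.not)).and
      ((primrecPred_imp (hmod 2) (primrecPred_iff hT hE)).and
      ((primrecPred_imp (hmod 3) (primrecPred_iff hT (hL.and hR))).and
      ((primrecPred_imp (hmod 4) (primrecPred_iff hT (hL.or hR))).and
      ((primrecPred_imp (hmod 5) (primrecPred_iff hT (primrecPred_imp hL hR))).and
      (primrecPred_imp (hmod 6) (primrecPred_iff hT (primrecPred_iff hL hR))))))))))

/-- A truth table obeying the semantic clauses computes truth in the coded frame. -/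
theorem sat_iff_tableBit {s r t c : ℕ}
    (ht : ∀ e < c + 1, ∀ w < s + 1, TableRule s r t e w) {φ : Formula} (hφ : φ.code ≤ c)
    (w : (bitFrame.{u} s r).W) :
    φ.Sat (bitFrame.{u} s r) (fun i => {w | TableBit s t (Formula.var i).code w.down}) w ↔
      TableBit s t φ.code w.down := by
  have hrule := ht φ.code (by omega)
  -- Pairing dominates both arguments, so the codes of immediate subformulas remain among the rows
  -- of the table.
  have hpair : ∀ {φ ψ : Formula} {d k : ℕ}, k = 7 * Nat.pair φ.code ψ.code + d → k ≤ c →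
      φ.code ≤ c ∧ ψ.code ≤ c := fun {φ ψ d k} h hk => by
    have h₁ := Nat.left_le_pair φ.code ψ.code
    have h₂ := Nat.right_le_pair φ.code ψ.code
    omega
  have hdiv : ∀ a d, d < 7 → (7 * a + (d + 2) - 2) / 7 = a := by intro a d hd; omega
  have hmod : ∀ a d, d < 7 → (7 * a + (d + 2) - 2) % 7 = d := by intro a d hd; omega
  have hlt : ∀ a d, 1 < 7 * a + (d + 2) := by intro a d; omega
  induction φ generalizing w with
  | var i => exact Iff.rfl
  | bot =>
    exact ⟨False.elim, (hrule w.down w.down.2).1 rfl⟩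
  | top =>
    exact ⟨fun _ => (hrule w.down w.down.2).2.1 rfl, fun _ => trivial⟩
  | neg φ ih =>
    have hφ' : φ.code ≤ c := by rw [Formula.code] at hφ; omega
    have h := ((hrule w.down w.down.2).2.2 (hlt φ.code 1)).1 (hmod φ.code 1 (by omega))
    refine Iff.trans (not_congr (ih hφ' w (ht _ (by omega)))) ?_
    rw [h, Formula.code, hdiv φ.code 1 (by omega)]
  | dia φ ih =>
    have hφ' : φ.code ≤ c := by rw [Formula.code] at hφ; omega
    have h := ((hrule w.down w.down.2).2.2 (hlt φ.code 2)).2.1 (hmod φ.code 2 (by omega))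
    rw [h, Formula.code, hdiv φ.code 2 (by omega), ← bitFrame_exists.{u} (r := r)]
    exact exists_congr fun v => and_congr_right fun _ => ih hφ' v (ht _ (by omega))
  | and φ ψ ih₁ ih₂ =>
    obtain ⟨h₁, h₂⟩ := hpair rfl hφ
    have h := ((hrule w.down w.down.2).2.2 (hlt _ 3)).2.2.1 (hmod _ 3 (by omega))
    refine Iff.trans (and_congr (ih₁ h₁ w (ht _ (by omega))) (ih₂ h₂ w (ht _ (by omega)))) ?_
    rw [h, Formula.code, hdiv _ 3 (by omega), Nat.unpair_pair]
  | or φ ψ ih₁ ih₂ =>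
    obtain ⟨h₁, h₂⟩ := hpair rfl hφ
    have h := ((hrule w.down w.down.2).2.2 (hlt _ 4)).2.2.2.1 (hmod _ 4 (by omega))
    refine Iff.trans (or_congr (ih₁ h₁ w (ht _ (by omega))) (ih₂ h₂ w (ht _ (by omega)))) ?_
    rw [h, Formula.code, hdiv _ 4 (by omega), Nat.unpair_pair]
  | imp φ ψ ih₁ ih₂ =>
    obtain ⟨h₁, h₂⟩ := hpair rfl hφ
    have h := ((hrule w.down w.down.2).2.2 (hlt _ 5)).2.2.2.2.1 (hmod _ 5 (by omega))
    refine Iff.trans (imp_congr (ih₁ h₁ w (ht _ (by omega))) (ih₂ h₂ w (ht _ (by omega)))) ?_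
    rw [h, Formula.code, hdiv _ 5 (by omega), Nat.unpair_pair]
  | iff φ ψ ih₁ ih₂ =>
    obtain ⟨h₁, h₂⟩ := hpair rfl hφ
    have h := ((hrule w.down w.down.2).2.2 (hlt _ 6)).2.2.2.2.2 (hmod _ 6 (by omega))
    refine Iff.trans (iff_congr (ih₁ h₁ w (ht _ (by omega))) (ih₂ h₂ w (ht _ (by omega)))) ?_
    rw [h, Formula.code, hdiv _ 6 (by omega), Nat.unpair_pair]

/-- Truth in a minimal quotient that is constant on the fibres obeys the semantic clauses. -/
theorem tableRule_of_quotient {F : Frame.{u}} {θ : ℕ → Set F.W} {s r t c : ℕ}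
    {g : F.W → Fin (s + 1)} (hsurj : Function.Surjective g)
    (hinv : ∀ x y, g x = g y → ∀ e ≤ c,
      ((Formula.ofCode e).Sat F θ x ↔ (Formula.ofCode e).Sat F θ y))
    (hr : ∀ u v : Fin (s + 1), EdgeBit s r u v ↔ ∃ x y, g x = u ∧ g y = v ∧ F.R x y)
    (ht : ∀ e ≤ c, ∀ x, TableBit s t e (g x) ↔ (Formula.ofCode e).Sat F θ x)
    {e w : ℕ} (he : e ≤ c) (hw : w < s + 1) : TableRule s r t e w := by
  obtain ⟨x, hx⟩ := hsurj ⟨w, hw⟩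
  obtain rfl : (g x : ℕ) = w := by rw [hx]
  refine ⟨?_, ?_, fun h1 => ?_⟩
  · rintro rfl
    rw [ht 0 he, Formula.ofCode]
    exact id
  · rintro rfl
    rw [ht 1 he, Formula.ofCode]
    trivial
  · obtain ⟨k, rfl⟩ := Nat.exists_eq_add_of_le' h1
    have hk : k / 7 ≤ c := by omega
    have hk₁ : (k / 7).unpair.1 ≤ c := (Nat.unpair_left_le _).trans hk
    have hk₂ : (k / 7).unpair.2 ≤ c := (Nat.unpair_right_le _).trans hk
    have h2 : k + 1 + 1 - 2 = k := rfl
    rw [h2]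
    refine ⟨?_, ?_, ?_, ?_, ?_, ?_⟩ <;> intro hm
    · rw [ht _ he, ht _ hk, Formula.ofCode, hm]
      exact Iff.rfl
    · rw [ht _ he, Formula.ofCode, hm]
      constructor
      · rintro ⟨y, hxy, hy⟩
        exact ⟨g y, (g y).2, (hr _ _).2 ⟨x, y, rfl, rfl, hxy⟩, (ht _ hk y).2 hy⟩
      · rintro ⟨v, hv, hxv, hy⟩
        obtain ⟨x', y, hx', hyv, hxy⟩ := (hr (g x) ⟨v, hv⟩).1 hxv
        obtain rfl : (g y : ℕ) = v := by rw [hyv]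
        -- The edge of `F` starts at `x'`, possibly different from `x`. The diamond formula holds at
        -- `x'` and is itself constant on fibres, which brings it back to `x`.
        have hdia : (Formula.ofCode (k + 2)).Sat F θ x' := by
          rw [Formula.ofCode, hm]
          exact ⟨y, hxy, (ht _ hk y).1 hy⟩
        have := (hinv _ _ hx' _ he).1 hdia
        rwa [Formula.ofCode, hm] at this
    · rw [ht _ he, ht _ hk₁, ht _ hk₂, Formula.ofCode, hm]
      exact Iff.rfl
    · rw [ht _ he, ht _ hk₁, ht _ hk₂, Formula.ofCode, hm]
      exact Iff.rfl
    · rw [ht _ he, ht _ hk₁, ht _ hk₂, Formula.ofCode, hm]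
      exact Iff.rfl
    · rw [ht _ he, ht _ hk₁, ht _ hk₂, Formula.ofCode, hm]
      exact Iff.rfl

theorem exists_testBit (M : ℕ) (P : ℕ → Prop) :
    ∃ r < 2 ^ M, ∀ k < M, (r.testBit k = true ↔ P k) := by
  classical
  refine ⟨Nat.ofBits fun i : Fin M => decide (P i), Nat.ofBits_lt_two_pow _, fun k hk => ?_⟩
  rw [Nat.testBit_ofBits_lt _ _ hk]
  simp

/-- A table with `a` rows of `s + 1` binary entries. -/
theorem exists_testBit_table (a s : ℕ) (P : ℕ → Fin (s + 1) → Prop) :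
    ∃ r < 2 ^ (a * (s + 1)), ∀ i < a, ∀ v : Fin (s + 1),
      (r.testBit (i * (s + 1) + v) = true ↔ P i v) := by
  obtain ⟨r, hr, h⟩ := exists_testBit (a * (s + 1)) fun k => P (k / (s + 1)) (Fin.ofNat (s + 1) k)
  refine ⟨r, hr, fun i hi v => ?_⟩
  have hlt : i * (s + 1) + v < a * (s + 1) := by
    have := Nat.mul_le_mul_right (s + 1) (Nat.succ_le_of_lt hi)
    rw [Nat.succ_mul] at this
    have := v.2
    omega
  rw [h _ hlt]
  have h₁ : (i * (s + 1) + v) / (s + 1) = i := by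
    rw [mul_comm, Nat.mul_add_div (Nat.succ_pos s), Nat.div_eq_of_lt v.2, add_zero]
  have h₂ : Fin.ofNat (s + 1) (i * (s + 1) + v) = v := by
    apply Fin.ext
    rw [Fin.val_ofNat, mul_comm, Nat.mul_add_mod, Nat.mod_eq_of_lt v.2]
  rw [h₁, h₂]

/-- There is a coded countermodel in `C` with at most `b` points for the formula with Gödel
number `c`. -/
def HasCountermodel (C : Set Frame.{u}) (b c : ℕ) : Prop :=
  ∃ s < b, ∃ r < 2 ^ ((s + 1) * (s + 1)), ∃ t < 2 ^ ((c + 1) * (s + 1)),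
    bitFrame.{u} s r ∈ C ∧ (∀ e < c + 1, ∀ w < s + 1, TableRule s r t e w) ∧
      ∃ w < s + 1, ¬ TableBit s t c w

theorem primrecPred_hasCountermodel {C : Set Frame.{u}}
    (hC : PrimrecRel fun s r => bitFrame.{u} s r ∈ C) {b : ℕ → ℕ} (hb : Primrec b) :
    PrimrecPred fun c => HasCountermodel C (b c) c := by
  have hs₁ : Primrec fun p : ℕ × ℕ => p.2 + 1 := Primrec.succ.comp .snd
  have hc₂ : Primrec fun p : (ℕ × ℕ) × ℕ => p.1.1 + 1 := Primrec.succ.comp (.comp .fst .fst)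
  have hs₂ : Primrec fun p : (ℕ × ℕ) × ℕ => p.1.2 + 1 := Primrec.succ.comp (.comp .snd .fst)
  have hc : Primrec fun p : ((ℕ × ℕ) × ℕ) × ℕ => p.1.1.1 := .comp .fst (.comp .fst .fst)
  have hs : Primrec fun p : ((ℕ × ℕ) × ℕ) × ℕ => p.1.1.2 := .comp .snd (.comp .fst .fst)
  have hr : Primrec fun p : ((ℕ × ℕ) × ℕ) × ℕ => p.1.2 := .comp .snd .fst
  have ht : Primrec fun p : ((ℕ × ℕ) × ℕ) × ℕ => p.2 := .snd
  have hrule : PrimrecPred fun p : ((ℕ × ℕ) × ℕ) × ℕ =>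
      ∀ e < p.1.1.1 + 1, ∀ w < p.1.1.2 + 1, TableRule p.1.1.2 p.1.2 p.2 e w :=
    primrecPred_forall_lt (Primrec.succ.comp hc) <|
      primrecPred_forall_lt (Primrec.succ.comp (hs.comp .fst)) <|
        primrecPred_tableRule (hs.comp (.comp .fst .fst)) (hr.comp (.comp .fst .fst))
          (ht.comp (.comp .fst .fst)) (.comp .snd .fst) .snd
  exact primrecPred_exists_lt hb <|
    primrecPred_exists_lt (primrec_pow.comp (.const 2) (Primrec.nat_mul.comp hs₁ hs₁)) <|
      primrecPred_exists_lt (primrec_pow.comp (.const 2) (Primrec.nat_mul.comp hc₂ hs₂)) <|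
        (hC.comp hs hr).and <| hrule.and <|
          primrecPred_exists_lt (Primrec.succ.comp hs)
            (primrecPred_tableBit (hs.comp .fst) (ht.comp .fst) (hc.comp .fst) .snd).not

/-- The bound on the number of points of a countermodel. -/
def modelBound (N h c : ℕ) : ℕ := colourCount (2 ^ (c + 1) * 2 ^ N) h

/-- The logic of a class of frames of height at most `h` is the set of formulas without a small
countermodel, if the class is closed under minimal quotients lifting arrows modulo `N`. -/
theorem mem_log_iff {C : Set Frame.{u}} {N h : ℕ} [NeZero N] (hh : ∀ F ∈ C, F.HeightLE h)
    (hq : ∀ F ∈ C, ∀ (G : Frame.{u}) (g : F.W → G.W), IsMinQuotient F G g →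
      LiftsMod F.R N g → G ∈ C) (φ : Formula) :
    φ ∈ Log C ↔ ¬ HasCountermodel C (modelBound N h φ.code) φ.code := by
  constructor
  · rintro hφ ⟨s, -, r, -, t, -, hC, ht, w, hw, hn⟩
    exact hn ((sat_iff_tableBit ht le_rfl ⟨⟨w, hw⟩⟩).1 (hφ _ hC _ _))
  · intro hφ F hF θ x₀
    by_contra hx₀
    refine hφ ?_
    -- The basic label of a point is its truth set among all formulas with code at most `φ.code`.
    -- There are `2 ^ (φ.code + 1)` such sets, whence `modelBound`.
    obtain ⟨s, g, hsurj, hs, hl, hb⟩ := exists_colouring (N := N) (hh F hF)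
      (fun x => {e : Fin (φ.code + 1) | (Formula.ofCode e).Sat F θ x})
    rw [natCard_set, Nat.card_fin] at hs
    have hinv : ∀ x y, g x = g y → ∀ e ≤ φ.code,
        ((Formula.ofCode e).Sat F θ x ↔ (Formula.ofCode e).Sat F θ y) := fun x y hxy e he =>
      Set.ext_iff.1 (hb x y hxy) ⟨e, Nat.lt_succ_of_le he⟩
    obtain ⟨r, hr, hR⟩ := exists_testBit_table (s + 1) s
      fun i v => ∃ x y, (g x : ℕ) = i ∧ g y = v ∧ F.R x y
    obtain ⟨t, ht, hT⟩ := exists_testBit_table (φ.code + 1) s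
      fun e v => ∃ x, g x = v ∧ (Formula.ofCode e).Sat F θ x
    have hR' : ∀ u v : Fin (s + 1), EdgeBit s r u v ↔ ∃ x y, g x = u ∧ g y = v ∧ F.R x y := by
      intro u v
      refine (hR u u.2 v).trans ?_
      simp only [Fin.val_inj]
    have hT' : ∀ e ≤ φ.code, ∀ x, TableBit s t e (g x) ↔ (Formula.ofCode e).Sat F θ x := by
      intro e he x
      refine (hT e (by omega) (g x)).trans ⟨?_, fun h => ⟨x, rfl, h⟩⟩
      rintro ⟨y, hy, h⟩
      exact (hinv _ _ hy e he).1 h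
    refine ⟨s, hs, r, hr, t, ht, ?_, fun e he w hw => tableRule_of_quotient hsurj hinv hR' hT'
      (by omega) hw, g x₀, (g x₀).2, fun h => hx₀ ?_⟩
    · refine hq F hF (bitFrame s r) (fun x => ⟨g x⟩) ⟨?_, ?_⟩ ?_
      · rintro ⟨i⟩
        obtain ⟨x, rfl⟩ := hsurj i
        exact ⟨x, rfl⟩
      · intro u v
        exact (hR' u.down v.down).trans (exists₂_congr fun x y =>
          and_congr (ULift.down_inj (a := ⟨g x⟩) (b := u))
            (and_congr (ULift.down_inj (a := ⟨g y⟩) (b := v)) Iff.rfl))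
      · intro x x' y' hx hxy
        obtain ⟨y, L, hy, hL⟩ := hl x x' y' (ULift.up_injective hx) hxy
        exact ⟨y, L, congrArg ULift.up hy, hL⟩
    · rwa [hT' _ le_rfl, Formula.ofCode_code] at h

theorem isDecidable_log {C : Set Frame.{u}} {N h : ℕ} [NeZero N] (hh : ∀ F ∈ C, F.HeightLE h)
    (hq : ∀ F ∈ C, ∀ (G : Frame.{u}) (g : F.W → G.W), IsMinQuotient F G g →
      LiftsMod F.R N g → G ∈ C)
    (hC : PrimrecRel fun s r => bitFrame.{u} s r ∈ C) : IsDecidable (Log C) := by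
  have hb : Primrec (modelBound N h) :=
    primrec_colourCount (Primrec.nat_mul.comp
      (primrec_pow.comp (.const 2) Primrec.succ) (.const (2 ^ N))) h
  have hp : PrimrecPred fun φ : Formula =>
      HasCountermodel C (modelBound N h (Encodable.encode φ)) (Encodable.encode φ) :=
    (primrecPred_hasCountermodel hC hb).comp Primrec.encode
  exact (hp.not.of_eq fun φ => (mem_log_iff hh hq φ).symm).computablePred

end ModalLogic

theorem mainTheorem6 (m n h : ℕ) (hm : 1 ≤ m) (hmn : m < n) (hh : 1 ≤ h) :
    ModalLogic.IsDecidable (ModalLogic.Log (ModalLogic.classFH.{u} m n h)) ∧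
      ModalLogic.IsDecidable (ModalLogic.Log (ModalLogic.classGH.{u} m h)) := by
  -- The modulus `n - m` is the amount by which `Rⁿ ⊆ Rᵐ` shortens paths. For `m`-transitive frames
  -- residues play no role, and the modulus 1 makes the congruence vacuous.
  have : NeZero (n - m) := ⟨by omega⟩
  exact ⟨ModalLogic.isDecidable_log (N := n - m) (fun F hF => hF.2)
      (fun F hF G g hg hl => ⟨hg.mem_classF hmn hl hF.1, hg.heightLE hl hF.2⟩)
      (ModalLogic.primrecRel_bitFrame_mem_classFH hmn),
    ModalLogic.isDecidable_log (N := 1) (fun F hF => hF.2)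
      (fun F hF G g hg hl => ⟨hg.mem_classG hl hF.1, hg.heightLE hl hF.2⟩)
      ModalLogic.primrecRel_bitFrame_mem_classGH⟩
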